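/- Let $R_1$ and $R_2$ be binary linear feedback shift registers of lengths $L_1$ and $L_2$ that have maximal length, i.e. from every nonzero initial state $R_i$ produces an output sequence of least period $2^{L_i}-1$. Assume $\gcd(L_1,L_2)=1$ and $L_2\ge 2$. Start both registers in nonzero initial states, let $(a_i)_{i\ge 0}$ and $(b_i)_{i\ge 0}$ be their output sequences, and let $(c_j)_{j\ge 0}$ be the shrunken sequence, obtained from $(b_i)$ by keeping, in order, exactly the bits $b_i$ with $a_i=1$. The (minimal) characteristic polynomial of $(c_j)$ is the monic polynomial over $\mathrm{GF}(2)$ that is the characteristic polynomial of a linear recurrence satisfied by $(c_j)$ and divides the characteristic polynomial of every such recurrence (a recurrence $u_{n+m}=\sum_{i<m}r_iu_{n+i}$ has characteristic polynomial $x^m-\sum_{i<m}r_ix^i$ and length $m$). Then the characteristic polynomial of $(c_j)$ exists and has the form $P(x)^N$, where $P(x)\in \mathrm{GF}(2)[x]$ has degree $L_2$ and $N$ is an integer with $$2^{L_1-2}<N\le 2^{L_1-1}.$$ In particular the linear complexity $LC$ of $(c_j)$ (the length of the shortest linear recurrence that it satisfies) satisfies $$L_2\,2^{L_1-2}<LC\le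 L_2\,2^{L_1-1}.$$ (The powers of $2$ are rational numbers; for $L_1=1$, $2^{L_1-2}=1/2$.) -/

import Mathlib

open Polynomial

/-- Least period of a binary sequence: `T` is the smallest positive integer with `u (n + T) = u n`
for all `n`. -/
def IsLeastPeriod (u : ℕ → ZMod 2) (T : ℕ) : Prop :=
  IsLeast {t : ℕ | 0 < t ∧ Function.Periodic u t} T

/-- A binary LFSR of length `L` is a linear recurrence
`u (n + L) = ∑ i, coeffs i * u (n + i)` over `GF(2)`; the initial state `s` consists of the first
`L` output bits, the output sequence is `R.mkSol s`, and the characteristic polynomial is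
`R.charPoly = X ^ L - ∑ i, coeffs i * X ^ i`.
It has maximal length if every nonzero initial state gives an output sequence (a PN-sequence) of
the largest possible period, `2 ^ L - 1`. -/
def IsMaximalLength (R : LinearRecurrence (ZMod 2)) : Prop :=
  ∀ s : Fin R.order → ZMod 2, s ≠ 0 → IsLeastPeriod (R.mkSol s) (2 ^ R.order - 1)

/-- The shrunken sequence: the bits `b i` with `a i = 1`, in their order
(the others are discarded). `Nat.nth (fun i => a i = 1) j` is the position of the `j`-th one
of `a`, counted from zero. -/
noncomputable def shrunken (a b : ℕ → ZMod 2) : ℕ → ZMod 2 :=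
  fun j => b (Nat.nth (fun i => a i = 1) j)

/-- `p` is the (minimal) characteristic polynomial of the sequence `u`: it is the characteristic
polynomial of a linear recurrence satisfied by `u`, and it divides the characteristic polynomial of
every linear recurrence satisfied by `u`. All these polynomials are monic, so there is at most one
such `p`. -/
def IsMinimalCharPoly (u : ℕ → ZMod 2) (p : (ZMod 2)[X]) : Prop :=
  (∃ R : LinearRecurrence (ZMod 2), R.IsSolution u ∧ R.charPoly = p) ∧
    ∀ R : LinearRecurrence (ZMod 2), R.IsSolution u → p ∣ R.charPoly

/-- `m` is the linear complexity of `u`: the length of the shortest linear recurrence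
satisfied by `u`. -/
def IsLinearComplexity (u : ℕ → ZMod 2) (m : ℕ) : Prop :=
  IsLeast {k : ℕ | ∃ R : LinearRecurrence (ZMod 2), R.order = k ∧ R.IsSolution u} m

/-! Let S be the shift, T = 2^L₂ - 1, and k_j the position of the j-th one of a. A period of a has
length t = 2^L₁ - 1 and contains A = 2^(L₁-1) ones, so k_(j+A) = k_j + t. As gcd(L₁, L₂) = 1, t is
coprime to T, and the annihilator of b under S^t is generated by an irreducible P of degree L₂
(`IsMaximalLength.exists_prime_annihilator`). Over GF(2), P(S)^A = P(S^A), which kills c; so the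
minimal polynomial is P^N with N ≤ A.

Let L₁ ≥ 2 and suppose N ≤ B = A/2. Since P divides X^T - 1, c has period BT, and k_(j+B) - k_j is
constant mod T (`IsMaximalLength.positions_modEq`). The gaps of a mod T then have period B, so an
even number of the A gaps in one period are ≡ L₁. But this number is odd, by an involution on states
(`IsMaximalLength.card_nextOneModEq_cast`). For L₁ = 1 the lower bound only says N > 0. -/

/-! ### Recurrences as polynomials in the shift; periods. -/

/-- The shift operator on binary sequences. -/
def seqShift : Module.End (ZMod 2) (ℕ → ZMod 2) := LinearMap.funLeft _ _ (· + 1)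

theorem seqShift_pow_apply (n : ℕ) (u : ℕ → ZMod 2) (i : ℕ) : (seqShift ^ n) u i = u (i + n) := by
  induction n generalizing u i with
  | zero => simp
  | succ n ih =>
    rw [pow_succ, Module.End.mul_apply, ih]
    simp [seqShift, LinearMap.funLeft_apply, add_assoc]

theorem isSolution_iff_aeval_charPoly (R : LinearRecurrence (ZMod 2)) (u : ℕ → ZMod 2) :
    R.IsSolution u ↔ aeval seqShift R.charPoly u = 0 := by
  have key : ∀ n, aeval seqShift R.charPoly u n =
      u (n + R.order) - ∑ i, R.coeffs i * u (n + i) := by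
    intro n
    simp [LinearRecurrence.charPoly, aeval_monomial, seqShift_pow_apply, LinearMap.sub_apply,
      LinearMap.sum_apply, Module.algebraMap_end_apply]
  constructor
  · intro h
    funext n
    rw [key, h n, sub_self, Pi.zero_apply]
  · intro h n
    have := key n
    rw [h, Pi.zero_apply] at this
    exact (sub_eq_zero.mp this.symm)

theorem monic_of_ne_zero_zmod_two {p : (ZMod 2)[X]} (hp : p ≠ 0) : p.Monic := by
  have h : ∀ x : ZMod 2, x ≠ 0 → x = 1 := by decide
  exact h _ (leadingCoeff_ne_zero.mpr hp)

theorem exists_charPoly_eq {p : (ZMod 2)[X]} (hp : p.Monic) :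
    ∃ R : LinearRecurrence (ZMod 2), R.charPoly = p := by
  refine ⟨⟨p.natDegree, fun i => - p.coeff i⟩, ?_⟩
  simp only [LinearRecurrence.charPoly, map_neg, Finset.sum_neg_distrib, sub_neg_eq_add]
  conv_rhs => rw [hp.as_sum]
  rw [Fin.sum_univ_eq_sum_range (fun i => monomial i (p.coeff i))]
  simp [← C_mul_X_pow_eq_monomial]

theorem natDegree_charPoly (R : LinearRecurrence (ZMod 2)) : R.charPoly.natDegree = R.order := by
  have := R.charPoly_degree_eq_order
  exact natDegree_eq_of_degree_eq_some this

/-- A generator of the annihilator of a vector under an endomorphism. -/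
theorem exists_generator_annihilator {E : Type*} [AddCommGroup E] [Module (ZMod 2) E]
    (f : Module.End (ZMod 2) E) (x : E) :
    ∃ Q : (ZMod 2)[X], ∀ p : (ZMod 2)[X], aeval f p x = 0 ↔ Q ∣ p := by
  let I : Ideal (ZMod 2)[X] :=
    { carrier := {p | aeval f p x = 0}
      zero_mem' := by simp
      add_mem' := fun {p q} hp hq => by
        simp only [Set.mem_ofPred_eq] at hp hq ⊢
        simp [hp, hq]
      smul_mem' := fun q p hp => by
        simp only [Set.mem_ofPred_eq] at hp ⊢
        simp [hp] }
  refine ⟨Submodule.IsPrincipal.generator I, fun p => ?_⟩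
  rw [← Submodule.IsPrincipal.mem_iff_generator_dvd]
  rfl

theorem isMinimalCharPoly_of_forall {u : ℕ → ZMod 2} {p : (ZMod 2)[X]} (hp : p.Monic)
    (h : ∀ q : (ZMod 2)[X], aeval seqShift q u = 0 ↔ p ∣ q) : IsMinimalCharPoly u p := by
  constructor
  · obtain ⟨R, hR⟩ := exists_charPoly_eq hp
    exact ⟨R, (isSolution_iff_aeval_charPoly R u).mpr (hR ▸ (h p).mpr dvd_rfl), hR⟩
  · intro R hR
    exact (h _).mp ((isSolution_iff_aeval_charPoly R u).mp hR)

theorem IsMinimalCharPoly.isLinearComplexity {u : ℕ → ZMod 2} {p : (ZMod 2)[X]}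
    (h : IsMinimalCharPoly u p) : IsLinearComplexity u p.natDegree := by
  obtain ⟨⟨R, hR, rfl⟩, hdvd⟩ := h
  refine ⟨⟨R, (natDegree_charPoly R).symm, hR⟩, ?_⟩
  rintro _ ⟨R', rfl, hR'⟩
  rw [← natDegree_charPoly R']
  exact natDegree_le_of_dvd (hdvd R' hR') R'.charPoly_monic.ne_zero

theorem IsLeastPeriod.shift_eq_iff {u : ℕ → ZMod 2} {T : ℕ} (hu : IsLeastPeriod u T) (m n : ℕ) :
    (seqShift ^ m) u = (seqShift ^ n) u ↔ m ≡ n [MOD T] := by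
  obtain ⟨⟨hT, hper⟩, hmin⟩ := hu
  have hmul : ∀ q x, u (x + q * T) = u x := fun q x => by
    have := hper.nsmul q x
    simpa using this
  have hmod : ∀ m n : ℕ, m ≡ n [MOD T] → (seqShift ^ m) u = (seqShift ^ n) u := by
    intro m n h
    funext i
    rw [seqShift_pow_apply, seqShift_pow_apply, ← hper.map_mod_nat, ← hper.map_mod_nat (i + n)]
    congr 1
    exact h.add_left i
  have hle : ∀ m n : ℕ, m ≤ n → (seqShift ^ m) u = (seqShift ^ n) u → m ≡ n [MOD T] := by
    intro m n hmn h
    obtain ⟨d, rfl⟩ := Nat.exists_eq_add_of_le hmn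
    have hd : ∀ x, u (x + d) = u x := by
      intro x
      -- The hypothesis only sees indices ≥ m, so x is first moved up by a multiple of the period.
      obtain ⟨y, hy⟩ : ∃ y, x + m * T = y + m :=
        ⟨x + m * T - m, by have := Nat.le_mul_of_pos_right m hT; omega⟩
      have h1 := congrFun h y
      rw [seqShift_pow_apply, seqShift_pow_apply] at h1
      rw [← hmul m x, ← hmul m (x + d), hy, h1]
      congr 1
      omega
    have hr : Function.Periodic u (d % T) := by
      intro x
      rw [← hmul (d / T), add_assoc, mul_comm (d / T), Nat.mod_add_div, hd]
    have hzero : d % T = 0 := by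
      by_contra hne
      have := hmin ⟨Nat.pos_of_ne_zero hne, hr⟩
      have := Nat.mod_lt d hT
      omega
    exact ((Nat.modEq_iff_dvd' hmn).mpr (by simpa using Nat.dvd_of_mod_eq_zero hzero))
  refine ⟨fun h => ?_, hmod m n⟩
  rcases le_total m n with hmn | hmn
  · exact hle m n hmn h
  · exact (hle n m hmn h.symm).symm

/-- By the Chinese remainder theorem the multiples of t meet every residue class mod T. -/
theorem eq_of_eq_on_progression {u v : ℕ → ZMod 2} {t T : ℕ}
    (hco : Nat.Coprime t T) (hu : Function.Periodic u T) (hv : Function.Periodic v T)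
    (h : ∀ i, u (i * t) = v (i * t)) : u = v := by
  funext x
  obtain ⟨y, hy0, hyx⟩ := Nat.chineseRemainder hco 0 x
  obtain ⟨i, rfl⟩ := (Nat.modEq_zero_iff_dvd.mp hy0)
  have := h i
  rw [mul_comm i t, ← hu.map_mod_nat, ← hv.map_mod_nat, hyx, hu.map_mod_nat,
    hv.map_mod_nat] at this
  exact this

theorem Nat.exists_mul_modEq_of_coprime {t T : ℕ} (hco : Nat.Coprime t T) (x : ℕ) :
    ∃ i, i * t ≡ x [MOD T] := by
  obtain ⟨y, hy0, hyx⟩ := Nat.chineseRemainder hco 0 x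
  obtain ⟨i, rfl⟩ := (Nat.modEq_zero_iff_dvd.mp hy0)
  exact ⟨i, by rwa [mul_comm]⟩

/-! ### The nonzero solutions form a single shift orbit. -/

section MaximalLength

variable {R : LinearRecurrence (ZMod 2)}

theorem IsMaximalLength.isLeastPeriod (hR : IsMaximalLength R) {u : ℕ → ZMod 2}
    (hu : R.IsSolution u) (h0 : u ≠ 0) : IsLeastPeriod u (2 ^ R.order - 1) := by
  have h : u = R.mkSol fun i => u i := R.eq_mk_of_is_sol_of_eq_init' hu fun _ => rfl
  rw [h]
  apply hR
  intro hz
  apply h0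
  rw [h, hz]
  exact congrArg Subtype.val (map_zero R.toInit.symm)

theorem LinearRecurrence.IsSolution.seqShift_pow {u : ℕ → ZMod 2} (hu : R.IsSolution u) (n : ℕ) :
    R.IsSolution ((seqShift ^ n) u) := by
  intro i
  have := hu (i + n)
  simp only [seqShift_pow_apply]
  rw [add_right_comm i R.order n, this]
  exact Finset.sum_congr rfl fun k _ => by rw [add_right_comm]

theorem seqShift_pow_ne_zero {u : ℕ → ZMod 2} {T : ℕ} (hu : IsLeastPeriod u T) (h0 : u ≠ 0)
    (n : ℕ) : (seqShift ^ n) u ≠ 0 := by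
  intro h
  apply h0
  have hT := hu.1.1
  have h1 : (seqShift ^ (n * T)) u = (seqShift ^ 0) u :=
    (hu.shift_eq_iff _ _).mpr (Nat.modEq_zero_iff_dvd.mpr (dvd_mul_left _ _))
  obtain ⟨d, hd⟩ := Nat.exists_eq_add_of_le (Nat.le_mul_of_pos_right n hT)
  rw [hd, add_comm, pow_add, Module.End.mul_apply, h, map_zero] at h1
  simpa using h1.symm

theorem natCard_solSpace : Nat.card R.solSpace = 2 ^ R.order := by
  rw [Nat.card_congr R.toInit.toEquiv]
  simp

instance : Finite R.solSpace := Finite.of_equiv _ R.toInit.symm.toEquiv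

/-- The shifts of u within one period are distinct, and there are as many of them as nonzero
solutions. -/
theorem IsMaximalLength.exists_shift_eq (hR : IsMaximalLength R) {u v : ℕ → ZMod 2}
    (hu : R.IsSolution u) (hu0 : u ≠ 0) (hv : R.IsSolution v) (hv0 : v ≠ 0) :
    ∃ n < 2 ^ R.order - 1, (seqShift ^ n) u = v := by
  have hper := hR.isLeastPeriod hu hu0
  let F : Fin (2 ^ R.order - 1) → {w : R.solSpace // w ≠ 0} := fun n =>
    ⟨⟨(seqShift ^ (n : ℕ)) u, hu.seqShift_pow n⟩, fun h =>
      seqShift_pow_ne_zero hper hu0 n (congrArg Subtype.val h)⟩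
  have hinj : Function.Injective F := by
    intro m n h
    have h' : (seqShift ^ (m : ℕ)) u = (seqShift ^ (n : ℕ)) u :=
      congrArg (fun w => (w.1 : ℕ → ZMod 2)) h
    exact Fin.ext (((hper.shift_eq_iff _ _).mp h').eq_of_lt_of_lt m.2 n.2)
  have hcard : Nat.card {w : R.solSpace // w ≠ 0} = 2 ^ R.order - 1 := by
    have : Fintype R.solSpace := Fintype.ofFinite _
    classical
    rw [Nat.card_eq_fintype_card, Fintype.card_subtype_compl, Fintype.card_subtype_eq,
      ← Nat.card_eq_fintype_card, natCard_solSpace]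
  have hbij : Function.Bijective F :=
    (Nat.bijective_iff_injective_and_card F).mpr ⟨hinj, by simp [hcard]⟩
  obtain ⟨n, hn⟩ := hbij.2 ⟨⟨v, hv⟩, fun h => hv0 (congrArg Subtype.val h)⟩
  exact ⟨n, n.2, congrArg (fun w => (w.1 : ℕ → ZMod 2)) hn⟩

/-- The minimal polynomial of a decimated PN-sequence is irreducible of full degree. -/
theorem IsMaximalLength.exists_prime_annihilator (hR : IsMaximalLength R) {b : ℕ → ZMod 2}
    (hb : R.IsSolution b) (hb0 : b ≠ 0) {t : ℕ} (ht : Nat.Coprime t (2 ^ R.order - 1)) :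
    ∃ Q : (ZMod 2)[X], Prime Q ∧ Q.natDegree = R.order ∧
      ∀ p : (ZMod 2)[X], aeval (seqShift ^ t) p b = 0 ↔ Q ∣ p := by
  obtain ⟨Q, hQ⟩ := exists_generator_annihilator (seqShift ^ t) b
  have hper := hR.isLeastPeriod hb hb0
  set T := 2 ^ R.order - 1 with hTdef
  have hmem : ∀ p : (ZMod 2)[X], R.IsSolution (aeval (seqShift ^ t) p b) := by
    intro p
    rw [isSolution_iff_aeval_charPoly, ← expand_aeval, ← Module.End.mul_apply, ← map_mul, mul_comm,
      map_mul, Module.End.mul_apply, (isSolution_iff_aeval_charPoly R b).mp hb, map_zero]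
  have horb : ∀ v : ℕ → ZMod 2, R.IsSolution v → v ≠ 0 → ∃ i : ℕ,
      aeval (seqShift ^ t) (X ^ i : (ZMod 2)[X]) b = v := by
    intro v hv hv0
    obtain ⟨n, -, hn⟩ := hR.exists_shift_eq hb hb0 hv hv0
    obtain ⟨i, hi⟩ := Nat.exists_mul_modEq_of_coprime ht n
    refine ⟨i, ?_⟩
    rw [map_pow, aeval_X, ← pow_mul, mul_comm, ← hn]
    exact (hper.shift_eq_iff _ _).mpr hi
  have hXT : ∀ i, aeval (seqShift ^ t) (X ^ (i * T) : (ZMod 2)[X]) b = b := by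
    intro i
    rw [map_pow, aeval_X, ← pow_mul, (hper.shift_eq_iff _ 0).mpr]
    · simp
    · exact Nat.modEq_zero_iff_dvd.mpr ⟨t * i, by ring⟩
  have hT := hper.1.1
  have hQ0 : Q ≠ 0 := by
    rintro rfl
    have h1 := (hQ (X ^ T - 1)).mp (by
      have := hXT 1
      rw [one_mul] at this
      simp only [map_sub, LinearMap.sub_apply, this]
      simp)
    exact (X_pow_sub_C_ne_zero hT (1 : ZMod 2)) (by simpa using h1)
  have hprime : Prime Q := by
    refine ⟨hQ0, fun hu => ?_, fun g h hgh => ?_⟩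
    · have := (hQ 1).mpr (isUnit_iff_dvd_one.mp hu)
      exact hb0 (by simpa using this)
    -- The nonzero vector g·b is X^i·b for some i, so h·X^i kills b; multiplying on to X^(iT), which
    -- fixes b, shows that h kills b.
    · by_contra! hcon
      rw [← hQ, ← hQ] at hcon
      rw [← hQ] at hgh
      obtain ⟨i, hi⟩ := horb _ (hmem g) hcon.1
      obtain ⟨d, hd⟩ := Nat.exists_eq_add_of_le (Nat.le_mul_of_pos_right i hT)
      apply hcon.2
      rw [mul_comm, map_mul, Module.End.mul_apply, ← hi, ← Module.End.mul_apply, ← map_mul] at hgh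
      have h2 := congrArg (aeval (seqShift ^ t) (X ^ d : (ZMod 2)[X])) hgh
      rw [map_zero, ← Module.End.mul_apply, ← map_mul] at h2
      have h3 : (X ^ d * (h * X ^ i) : (ZMod 2)[X]) = h * X ^ (i * T) := by rw [hd]; ring
      rwa [h3, map_mul, Module.End.mul_apply, hXT] at h2
  refine ⟨Q, hprime, ?_, hQ⟩
  have hmon := monic_of_ne_zero_zmod_two hQ0
  -- The degree comes from a dimension count: p ↦ p·b identifies the polynomials of degree below deg
  -- Q with the solution space.
  let ψ : (ZMod 2)[X] →ₗ[ZMod 2] R.solSpace :=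
    { toFun := fun p => ⟨aeval (seqShift ^ t) p b, hmem p⟩
      map_add' := fun p q => by ext1; simp
      map_smul' := fun c p => by ext1; simp }
  have hψ : ∀ p, ψ p = 0 ↔ Q ∣ p := fun p => by
    rw [← hQ]
    exact ⟨fun h => congrArg Subtype.val h, fun h => Subtype.ext h⟩
  have hbij : Function.Bijective (ψ ∘ₗ (degreeLT (ZMod 2) Q.natDegree).subtype) := by
    constructor
    · rw [← LinearMap.ker_eq_bot, LinearMap.ker_eq_bot']
      rintro ⟨p, hp⟩ h
      have hdvd := (hψ p).mp h
      ext1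
      rw [mem_degreeLT, ← degree_eq_natDegree hQ0] at hp
      exact eq_zero_of_dvd_of_degree_lt hdvd hp
    · intro v
      obtain ⟨p, hp⟩ : ∃ p, ψ p = v := by
        by_cases hv : v = 0
        · exact ⟨0, by rw [map_zero, hv]⟩
        · obtain ⟨i, hi⟩ := horb v v.2 (fun h => hv (Subtype.ext h))
          exact ⟨X ^ i, Subtype.ext hi⟩
      refine ⟨⟨p %ₘ Q, ?_⟩, ?_⟩
      · rw [mem_degreeLT, ← degree_eq_natDegree hQ0]
        exact degree_modByMonic_lt p hmon
      · have h0 : ψ (Q * (p /ₘ Q)) = 0 := (hψ _).mpr (dvd_mul_right _ _)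
        have h1 := congrArg ψ (modByMonic_add_div p Q)
        rw [map_add, h0, add_zero, hp] at h1
        exact h1
  have e := ((degreeLTEquiv (ZMod 2) Q.natDegree).symm.trans
    (LinearEquiv.ofBijective _ hbij)).trans R.toInit
  simpa using e.finrank_eq

end MaximalLength

/-! ### Ones and gaps of a PN-sequence. -/

section Counting

variable {R : LinearRecurrence (ZMod 2)}

/-- Exactly half of the solutions of a recurrence of positive order start with a one. -/
theorem card_filter_apply_zero_eq_one [Fintype R.solSpace] (hpos : 0 < R.order) :
    2 * (Finset.univ.filter fun u : R.solSpace => (u : ℕ → ZMod 2) 0 = 1).card = 2 ^ R.order := by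
  have hdec : ∀ x : ZMod 2, (x = 1 ↔ ¬ (x + 1 = 1)) := by decide
  let e : R.solSpace := R.toInit.symm (fun _ => 1)
  have he : (e : ℕ → ZMod 2) 0 = 1 :=
    congrFun (R.toInit.apply_symm_apply (fun _ => 1)) ⟨0, hpos⟩
  have hcard : (Finset.univ.filter fun u : R.solSpace => (u : ℕ → ZMod 2) 0 = 1).card =
      (Finset.univ.filter fun u : R.solSpace => ¬ (u : ℕ → ZMod 2) 0 = 1).card := by
    refine Finset.card_bij' (fun u _ => u + e) (fun u _ => u - e) ?_ ?_ ?_ ?_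
    · intro u hu
      simp only [Finset.mem_filter, Finset.mem_univ, true_and, Submodule.coe_add,
        Pi.add_apply, he] at hu ⊢
      exact (hdec _).mp hu
    · intro u hu
      simp only [Finset.mem_filter, Finset.mem_univ, true_and, AddSubgroupClass.coe_sub,
        Pi.sub_apply, he] at hu ⊢
      rw [hdec]
      simpa using hu
    · intro u _; simp
    · intro u _; simp
  rw [← natCard_solSpace, Nat.card_eq_fintype_card, ← Finset.card_univ,
    ← Finset.card_filter_add_card_filter_not
      (s := Finset.univ) (fun u : R.solSpace => (u : ℕ → ZMod 2) 0 = 1), ← hcard]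
  ring

/-- The shifts over one period run once through the nonzero solutions, and half of all solutions
start with a one. -/
theorem IsMaximalLength.count_eq (hR : IsMaximalLength R) {a : ℕ → ZMod 2}
    (ha : R.IsSolution a) (ha0 : a ≠ 0) (hpos : 0 < R.order) :
    Nat.count (fun i => a i = 1) (2 ^ R.order - 1) = 2 ^ (R.order - 1) := by
  have : Fintype R.solSpace := Fintype.ofFinite _
  have hper := hR.isLeastPeriod ha ha0
  have h := card_filter_apply_zero_eq_one (R := R) hpos
  have h2 : 2 ^ R.order = 2 * 2 ^ (R.order - 1) := by
    rw [← pow_succ', Nat.sub_add_cancel hpos]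
  rw [h2] at h
  rw [← Nat.eq_of_mul_eq_mul_left two_pos h, Nat.count_eq_card_filter_range]
  refine Finset.card_bij (fun n _ => ⟨(seqShift ^ n) a, ha.seqShift_pow n⟩) ?_ ?_ ?_
  · intro n hn
    simpa [seqShift_pow_apply] using (Finset.mem_filter.mp hn).2
  · intro m hm n hn hmn
    simp only [Finset.mem_filter, Finset.mem_range] at hm hn
    exact ((hper.shift_eq_iff _ _).mp (congrArg Subtype.val hmn)).eq_of_lt_of_lt hm.1 hn.1
  · rintro ⟨v, hv⟩ hv1
    replace hv1 : v 0 = 1 := (Finset.mem_filter.mp hv1).2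
    obtain ⟨n, hn, rfl⟩ := hR.exists_shift_eq ha ha0 hv (fun h => by simp [h] at hv1)
    rw [seqShift_pow_apply, zero_add] at hv1
    exact ⟨n, by simp [hn, hv1], rfl⟩

theorem infinite_ones {a : ℕ → ZMod 2} {T : ℕ} (ha : IsLeastPeriod a T) (ha0 : a ≠ 0) :
    (Set.ofPred fun i => a i = 1).Infinite := by
  obtain ⟨i, hi⟩ := Function.ne_iff.mp ha0
  have h : ∀ x : ZMod 2, x ≠ 0 → x = 1 := by decide
  refine Set.infinite_of_not_bddAbove ?_
  rintro ⟨m, hm⟩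
  have h1 : a (i + (m + 1) * T) = 1 := by
    have := ha.1.2.nsmul (m + 1) i
    rw [smul_eq_mul] at this
    rw [this]
    exact h _ hi
  have h2 : i + (m + 1) * T ≤ m := hm h1
  have := Nat.le_mul_of_pos_right (m + 1) ha.1.1
  omega

theorem Nat.nth_add_of_periodic {p : ℕ → Prop} [DecidablePred p] {T : ℕ}
    (hp : ∀ n, p (n + T) ↔ p n) (hinf : (Set.ofPred p).Infinite) (j : ℕ) :
    Nat.nth p (j + Nat.count p T) = Nat.nth p j + T := by
  have h1 : p (Nat.nth p j + T) := (hp _).mpr (Nat.nth_mem_of_infinite hinf j)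
  have h2 : Nat.count p (Nat.nth p j + T) = j + Nat.count p T := by
    rw [Nat.count_add']
    simp only [hp]
    rw [Nat.count_nth_of_infinite hinf]
  rw [← h2, Nat.nth_count h1]

/-- The sequence starts with a one, and the distance to the next one is congruent to `L`
modulo `T`. -/
def NextOneModEq (L T : ℕ) (u : ℕ → ZMod 2) : Prop :=
  u 0 = 1 ∧ ∃ g, 0 < g ∧ g ≡ L [MOD T] ∧ u g = 1 ∧ ∀ i, 0 < i → i < g → u i = 0

theorem nextOneModEq_shift_nth {a : ℕ → ZMod 2}
    (hinf : (Set.ofPred fun i => a i = 1).Infinite) (L T j : ℕ) :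
    NextOneModEq L T ((seqShift ^ Nat.nth (fun i => a i = 1) j) a) ↔
      Nat.nth (fun i => a i = 1) (j + 1) - Nat.nth (fun i => a i = 1) j ≡ L [MOD T] := by
  set k := Nat.nth (fun i => a i = 1) with hk
  have hmem : ∀ j, a (k j) = 1 := Nat.nth_mem_of_infinite hinf
  have hlt : k j < k (j + 1) := Nat.nth_strictMono hinf (Nat.lt_succ_self j)
  have h01 : ∀ x : ZMod 2, x ≠ 1 → x = 0 := by decide
  have hbetween : ∀ x, k j < x → x < k (j + 1) → a x = 0 := by
    intro x h1 h2
    by_contra hx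
    have hx1 : a x = 1 := by
      by_contra h; exact hx (h01 _ h)
    exact h1.not_ge (Nat.le_nth_of_lt_nth_succ (p := fun i => a i = 1) h2 hx1)
  unfold NextOneModEq
  simp only [seqShift_pow_apply, zero_add, hmem, true_and]
  constructor
  · rintro ⟨g, hg, hmod, h1, h0⟩
    suffices g = k (j + 1) - k j by rwa [← this]
    rcases lt_trichotomy g (k (j + 1) - k j) with h | h | h
    · rw [hbetween (g + k j) (by omega) (by omega)] at h1
      simp at h1
    · exact h
    · have := h0 (k (j + 1) - k j) (by omega) h
      rw [Nat.sub_add_cancel hlt.le, hmem] at this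
      simp at this
  · intro h
    refine ⟨_, by omega, h, by rw [Nat.sub_add_cancel hlt.le, hmem], fun i h1 h2 => ?_⟩
    exact hbetween _ (by omega) (by omega)

open Classical in
/-- All solutions with a gap congruent to `L` modulo `T` are paired by flipping the last bit of
the initial state, except for the one with initial state `1, 0, …, 0`. -/
theorem IsMaximalLength.card_nextOneModEq_cast [Fintype R.solSpace] (hR : IsMaximalLength R)
    (htwo : 2 ≤ R.order) {T : ℕ} (hT : 2 ≤ T) :
    (((Finset.univ.filter fun u : R.solSpace =>
      NextOneModEq R.order T (u : ℕ → ZMod 2)).card : ℕ) : ZMod 2) = 1 := by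
  set L := R.order with hL
  have h01 : ∀ x : ZMod 2, x ≠ 0 → x = 1 := by decide
  have hext : ∀ u v : R.solSpace, (∀ i < L, (u : ℕ → ZMod 2) i = (v : ℕ → ZMod 2) i) → u = v :=
    fun u v h => R.toInit.injective (funext fun i => h i i.2)
  have hinit : ∀ (s : Fin L → ZMod 2) (i : ℕ) (hi : i < L),
      (R.toInit.symm s : ℕ → ZMod 2) i = s ⟨i, hi⟩ := fun s i hi =>
    congrFun (R.toInit.apply_symm_apply s) ⟨i, hi⟩
  have hnz : ∀ u : R.solSpace, u ≠ 0 → ∀ n, (seqShift ^ n) (u : ℕ → ZMod 2) ≠ 0 := fun u hu n =>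
    seqShift_pow_ne_zero (hR.isLeastPeriod u.2 (fun h => hu (Subtype.ext h)))
      (fun h => hu (Subtype.ext h)) n
  have hone : ∀ u : R.solSpace, (u : ℕ → ZMod 2) 0 = 1 →
      ∃ g, 0 < g ∧ g ≤ L ∧ (u : ℕ → ZMod 2) g = 1 := by
    intro u hu
    by_contra! hcon
    -- L zeros after the leading one would be a zero state.
    have hz : (⟨_, u.2.seqShift_pow 1⟩ : R.solSpace) = 0 := hext _ _ fun i hi => by
      simp only [seqShift_pow_apply, ZeroMemClass.coe_zero, Pi.zero_apply]
      by_contra h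
      exact hcon (i + 1) (by omega) (by omega) (h01 _ h)
    exact hnz u (fun h => by simp [h] at hu) 1 (congrArg Subtype.val hz)
  let w : R.solSpace := R.toInit.symm fun i => if (i : ℕ) = 0 then 1 else 0
  let e : R.solSpace := R.toInit.symm fun i => if (i : ℕ) = L - 1 then 1 else 0
  have hw : ∀ i < L, (w : ℕ → ZMod 2) i = if i = 0 then 1 else 0 := fun i hi => hinit _ i hi
  have he : ∀ i < L, (e : ℕ → ZMod 2) i = if i = L - 1 then 1 else 0 := fun i hi => hinit _ i hi
  have hw0 : (w : ℕ → ZMod 2) 0 = 1 := by rw [hw 0 (by omega), if_pos rfl]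
  have hwmem : NextOneModEq L T (w : ℕ → ZMod 2) := by
    obtain ⟨g, hg, hgL, hg1⟩ := hone w hw0
    have hgeq : g = L := by
      by_contra hne
      rw [hw g (by omega), if_neg hg.ne'] at hg1
      simp at hg1
    rw [hgeq] at hg hg1
    exact ⟨hw0, L, hg, Nat.ModEq.refl _, hg1, fun i h1 h2 => by rw [hw i h2, if_neg h1.ne']⟩
  have hsmall : ∀ u : R.solSpace, NextOneModEq L T (u : ℕ → ZMod 2) → u ≠ w →
      ∃ g, 0 < g ∧ g + 1 < L ∧ g ≡ L [MOD T] ∧ (u : ℕ → ZMod 2) g = 1 ∧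
        ∀ i, 0 < i → i < g → (u : ℕ → ZMod 2) i = 0 := by
    rintro u ⟨hu0, g, hg, hmod, hg1, hbet⟩ hne
    refine ⟨g, hg, ?_, hmod, hg1, hbet⟩
    obtain ⟨g', hg', hgL', hg1'⟩ := hone u hu0
    have hle : g ≤ g' := by
      by_contra h
      rw [hbet g' hg' (by omega)] at hg1'
      simp at hg1'
    have hneL : g ≠ L := by
      rintro rfl
      refine hne (hext _ _ fun i hi => ?_)
      rw [hw i hi]
      split_ifs with h
      · rw [h, hu0]
      · exact hbet i (Nat.pos_of_ne_zero h) hi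
    -- The gap L - 1 is excluded because T ≥ 2; hence the last bit lies beyond the next one and
    -- flipping it keeps the gap.
    have hneL' : g + 1 ≠ L := by
      intro h
      have h1 : g + 0 ≡ g + 1 [MOD T] := by rw [h]; exact hmod
      have h2 := (Nat.ModEq.add_left_cancel' g h1).eq_of_lt_of_lt (by omega) (by omega)
      omega
    omega
  have hflip : ∀ u : R.solSpace, NextOneModEq L T (u : ℕ → ZMod 2) → u ≠ w →
      NextOneModEq L T ((u + e : R.solSpace) : ℕ → ZMod 2) ∧ u + e ≠ w := by
    intro u hu hne
    obtain ⟨g, hg, hgL, hmod, hg1, hbet⟩ := hsmall u hu hne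
    have hsame : ∀ i, i + 1 < L → ((u + e : R.solSpace) : ℕ → ZMod 2) i = (u : ℕ → ZMod 2) i := by
      intro i hi
      rw [Submodule.coe_add, Pi.add_apply, he i (by omega), if_neg (by omega), add_zero]
    refine ⟨⟨by rw [hsame 0 (by omega), hu.1], g, hg, hmod, by rw [hsame g hgL, hg1],
      fun i h1 h2 => by rw [hsame i (by omega), hbet i h1 h2]⟩, fun h => ?_⟩
    have h3 := hsame g hgL
    rw [h, hg1, hw g (by omega), if_neg hg.ne'] at h3
    simp at h3
  have hene : e ≠ 0 := by
    intro h
    have := he (L - 1) (by omega)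
    rw [if_pos rfl, h] at this
    simp at this
  have hee : e + e = 0 := by
    rw [← two_smul (ZMod 2) e, show (2 : ZMod 2) = 0 from rfl, zero_smul]
  set S := Finset.univ.filter fun u : R.solSpace => NextOneModEq L T (u : ℕ → ZMod 2) with hS
  have hwS : w ∈ S := by simp [hS, hwmem]
  have hrest : ∑ u ∈ S.erase w, (1 : ZMod 2) = 0 := by
    refine Finset.sum_involution (fun u _ => u + e) (fun _ _ => by decide)
      (fun u _ _ h => hene (by simpa using h)) ?_ ?_
    · intro u hu
      simp only [hS, Finset.mem_erase, Finset.mem_filter, Finset.mem_univ, true_and] at hu ⊢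
      exact (hflip u hu.2 hu.1).symm
    · intro u _
      rw [add_assoc, hee, add_zero]
  rw [← Finset.card_erase_add_one hwS, Nat.cast_add, Nat.cast_one]
  simpa using hrest

/-- The gap sequence of a PN-sequence modulo `T` does not have half the expected period. -/
theorem IsMaximalLength.gaps_not_periodic (hR : IsMaximalLength R) {a : ℕ → ZMod 2}
    (ha : R.IsSolution a) (ha0 : a ≠ 0) (htwo : 2 ≤ R.order) {T : ℕ} (hT : 2 ≤ T) {C : ℕ}
    (h : ∀ j, Nat.nth (fun i => a i = 1) (j + 2 ^ (R.order - 2)) ≡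
      Nat.nth (fun i => a i = 1) j + C [MOD T]) : False := by
  classical
  have : Fintype R.solSpace := Fintype.ofFinite _
  have hper := hR.isLeastPeriod ha ha0
  have hinf := infinite_ones hper ha0
  have hodd := hR.card_nextOneModEq_cast htwo hT
  have hcount := hR.count_eq ha ha0 (by omega)
  set k := Nat.nth (fun i => a i = 1) with hk
  set B := 2 ^ (R.order - 2) with hB
  have hA : 2 ^ (R.order - 1) = B + B := by
    rw [hB, ← two_mul, ← pow_succ']; congr 1; omega
  rw [hA] at hcount
  have hmono : StrictMono k := Nat.nth_strictMono hinf
  have hgap : ∀ j, (k (j + B + 1) - k (j + B) ≡ R.order [MOD T]) ↔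
      (k (j + 1) - k j ≡ R.order [MOD T]) := by
    intro j
    have h1 := h j
    have h2 := h (j + 1)
    rw [add_right_comm] at h2
    have l1 := hmono (Nat.lt_succ_self j)
    have l2 := hmono (Nat.lt_succ_self (j + B))
    simp only [Nat.succ_eq_add_one] at l1 l2
    have key : k (j + B + 1) - k (j + B) ≡ k (j + 1) - k j [MOD T] := by
      refine Nat.ModEq.add_right_cancel h1 ?_
      rw [Nat.sub_add_cancel l2.le, ← add_assoc, Nat.sub_add_cancel l1.le]
      exact h2
    exact ⟨fun h => key.symm.trans h, fun h => key.trans h⟩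
  have hbij : ((Finset.range (B + B)).filter
      fun j => k (j + 1) - k j ≡ R.order [MOD T]).card =
      (Finset.univ.filter fun u : R.solSpace =>
        NextOneModEq R.order T (u : ℕ → ZMod 2)).card := by
    have hklt : ∀ j < B + B, k j < 2 ^ R.order - 1 := fun j hj =>
      Nat.nth_lt_of_lt_count (hcount.symm ▸ hj)
    refine Finset.card_bij (fun j _ => ⟨(seqShift ^ k j) a, ha.seqShift_pow _⟩) ?_ ?_ ?_
    · intro j hj
      simp only [Finset.mem_filter, Finset.mem_univ, true_and] at hj ⊢
      exact (nextOneModEq_shift_nth hinf _ _ _).mpr hj.2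
    · intro i hi j hj hij
      simp only [Finset.mem_filter, Finset.mem_range] at hi hj
      exact hmono.injective (((hper.shift_eq_iff _ _).mp
        (congrArg Subtype.val hij)).eq_of_lt_of_lt (hklt i hi.1) (hklt j hj.1))
    · rintro ⟨v, hv⟩ hv1
      simp only [Finset.mem_filter, Finset.mem_univ, true_and] at hv1
      obtain ⟨n, hn, rfl⟩ := hR.exists_shift_eq ha ha0 hv
        (fun h => by simp [h, NextOneModEq] at hv1)
      have hn1 : a n = 1 := by simpa [seqShift_pow_apply] using hv1.1
      have hkn : k (Nat.count (fun i => a i = 1) n) = n := Nat.nth_count (p := fun i => a i = 1) hn1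
      refine ⟨Nat.count (fun i => a i = 1) n, ?_, by simp [hkn]⟩
      simp only [Finset.mem_filter, Finset.mem_range]
      refine ⟨hcount ▸ Nat.count_strict_mono (p := fun i => a i = 1) hn1 hn, ?_⟩
      rw [← nextOneModEq_shift_nth hinf, ← hk, hkn]
      exact hv1
  -- The two halves of the period contribute equally, so the odd count would be even.
  rw [← hbij, Finset.card_filter, Nat.cast_sum, Finset.sum_range_add] at hodd
  simp only [add_comm B, hgap] at hodd
  exact absurd (CharTwo.add_self_eq_zero _) (hodd ▸ one_ne_zero)

end Counting

/-! ### Minimal polynomial of a sampled PN-sequence. -/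

theorem expand_two_pow_eq_pow (Q : (ZMod 2)[X]) (m : ℕ) :
    expand (ZMod 2) (2 ^ m) Q = Q ^ 2 ^ m := by
  induction m with
  | zero => simp
  | succ m ih => rw [pow_succ', expand_mul, ih, ZMod.expand_card, ← pow_mul, mul_comm]

/-- Advancing A samples advances the source by t, so sampling intertwines S^A with S^t. -/
theorem aeval_seqShift_comp {k : ℕ → ℕ} {A t : ℕ} (hk : ∀ j, k (j + A) = k j + t)
    (p : (ZMod 2)[X]) (u : ℕ → ZMod 2) :
    aeval (seqShift ^ A) p (fun j => u (k j)) =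
      fun j => (aeval (seqShift ^ t) p u : ℕ → ZMod 2) (k j) := by
  have hpow : ∀ i j, k (j + A * i) = k j + t * i := by
    intro i
    induction i with
    | zero => simp
    | succ i ih =>
      intro j
      rw [Nat.mul_succ, ← add_assoc, hk, ih, Nat.mul_succ, add_assoc]
  induction p using Polynomial.induction_on' with
  | add p q hp hq =>
    funext j
    simp [hp, hq]
  | monomial i c =>
    funext j
    simp [aeval_monomial, ← pow_mul, Module.algebraMap_end_apply, seqShift_pow_apply, hpow]

theorem mkSol_ne_zero {R : LinearRecurrence (ZMod 2)} {s : Fin R.order → ZMod 2} (hs : s ≠ 0) :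
    R.mkSol s ≠ 0 := fun h => hs (funext fun i => by
  rw [← R.mkSol_eq_init s i, h, Pi.zero_apply, Pi.zero_apply])

section Decimation

variable {R : LinearRecurrence (ZMod 2)}

/-- A PN-sequence that is sampled along positions `k` with `k (j + A) = k j + t`, where `t` is
coprime to the period, has a power of an irreducible polynomial as minimal polynomial. -/
theorem IsMaximalLength.exists_minimalCharPoly_comp (hR : IsMaximalLength R) {b : ℕ → ZMod 2}
    (hb : R.IsSolution b) (hb0 : b ≠ 0) {k : ℕ → ℕ} {m t : ℕ}
    (hk : ∀ j, k (j + 2 ^ m) = k j + t) (ht : Nat.Coprime t (2 ^ R.order - 1)) :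
    ∃ (P : (ZMod 2)[X]) (N : ℕ), P.natDegree = R.order ∧ P.Monic ∧ 0 < N ∧ N ≤ 2 ^ m ∧
      P ∣ X ^ (2 ^ R.order - 1) - 1 ∧
      ∀ q : (ZMod 2)[X], aeval seqShift q (fun j => b (k j)) = 0 ↔ P ^ N ∣ q := by
  obtain ⟨P, hprime, hdeg, hP⟩ := hR.exists_prime_annihilator hb hb0 ht
  have hper := hR.isLeastPeriod hb hb0
  obtain ⟨G, hG⟩ := exists_generator_annihilator seqShift fun j => b (k j)
  have hmon := monic_of_ne_zero_zmod_two hprime.ne_zero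
  have hGdvd : G ∣ P ^ 2 ^ m := by
    rw [← hG, ← expand_two_pow_eq_pow, expand_aeval, aeval_seqShift_comp hk, (hP P).mpr dvd_rfl]
    rfl
  obtain ⟨N, hN, hGN⟩ := (dvd_prime_pow hprime _).mp hGdvd
  have hmul : ∀ i j, k (j + i * 2 ^ m) = k j + i * t := by
    intro i
    induction i with
    | zero => simp
    | succ i ih =>
      intro j
      rw [Nat.succ_mul, ← add_assoc, hk, ih, Nat.succ_mul, add_assoc]
  refine ⟨P, N, hdeg, hmon, ?_, hN, ?_, fun q => by rw [hG, hGN.dvd_iff_dvd_left]⟩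
  · refine Nat.pos_of_ne_zero fun h0 => ?_
    rw [h0, pow_zero] at hGN
    have h1 := (hG 1).mpr hGN.dvd
    rw [map_one, Module.End.one_apply] at h1
    -- For N = 0 the samples vanish, so b shifted by k 0 vanishes on the multiples of t, hence
    -- everywhere.
    refine seqShift_pow_ne_zero hper hb0 (k 0) ?_
    refine eq_of_eq_on_progression (v := 0) ht ?_ (fun _ => rfl) fun i => ?_
    · exact (hR.isLeastPeriod (hb.seqShift_pow _) (seqShift_pow_ne_zero hper hb0 _)).1.2
    · have h2 := congrFun h1 (0 + i * 2 ^ m)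
      rw [hmul, add_comm] at h2
      rw [seqShift_pow_apply]
      exact h2
  · rw [← hP, map_sub, LinearMap.sub_apply, map_pow, aeval_X, ← pow_mul,
      (hper.shift_eq_iff _ 0).mpr (Nat.modEq_zero_iff_dvd.mpr (dvd_mul_left _ _))]
    simp

/-- If half the expected power of the minimal polynomial annihilates the sampled sequence, then
the sampling positions have a smaller period modulo the period of the PN-sequence. -/
theorem IsMaximalLength.positions_modEq (hR : IsMaximalLength R) {b : ℕ → ZMod 2}
    (hb : R.IsSolution b) (hb0 : b ≠ 0) {k : ℕ → ℕ} {m t : ℕ}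
    (hk : ∀ j, k (j + 2 ^ (m + 1)) = k j + t) (ht : Nat.Coprime t (2 ^ R.order - 1))
    {P : (ZMod 2)[X]} (hP : P ∣ X ^ (2 ^ R.order - 1) - 1)
    (hann : aeval seqShift (P ^ 2 ^ m) (fun j => b (k j)) = 0) (j : ℕ) :
    k (j + 2 ^ m) + t * ((2 ^ R.order - 1) / 2) ≡ k j [MOD 2 ^ R.order - 1] := by
  have hper := hR.isLeastPeriod hb hb0
  have hper' := fun n =>
    (hR.isLeastPeriod (hb.seqShift_pow n) (seqShift_pow_ne_zero hper hb0 n)).1.2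
  have hodd : 2 * ((2 ^ R.order - 1) / 2) + 1 = 2 ^ R.order - 1 := by
    obtain ⟨n, hn⟩ : ∃ n, R.order = n + 1 := Nat.exists_eq_succ_of_ne_zero (by
      intro h
      have := hper.1.1
      simp [h] at this)
    rw [hn, pow_succ]
    have := Nat.one_le_two_pow (n := n)
    omega
  set T := 2 ^ R.order - 1
  have hperiod : ∀ j, b (k (j + 2 ^ m * T)) = b (k j) := by
    have h1 : P ^ 2 ^ m ∣ expand (ZMod 2) (2 ^ m) (X ^ T - 1) := by
      rw [expand_two_pow_eq_pow]
      exact pow_dvd_pow_of_dvd hP _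
    obtain ⟨g, hg⟩ := h1
    have h2 : aeval seqShift (expand (ZMod 2) (2 ^ m) (X ^ T - 1)) (fun j => b (k j)) = 0 := by
      rw [hg, mul_comm, map_mul, Module.End.mul_apply, hann, map_zero]
    rw [expand_aeval, map_sub, map_pow, aeval_X, map_one, ← pow_mul, LinearMap.sub_apply,
      Module.End.one_apply, sub_eq_zero] at h2
    intro j
    have h3 := congrFun h2 j
    rwa [seqShift_pow_apply] at h3
  have hmul : ∀ i j, k (j + 2 ^ (m + 1) * i) = k j + t * i := by
    intro i
    induction i with
    | zero => simp
    | succ i ih =>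
      intro j
      rw [Nat.mul_succ, ← add_assoc, hk, ih, Nat.mul_succ, add_assoc]
  -- T is odd, so the period 2^m·T is 2^m plus whole blocks of 2^(m+1) samples.
  have hshift : j + 2 ^ m * T = j + 2 ^ m + 2 ^ (m + 1) * (T / 2) := by
    conv_lhs => rw [← hodd]
    ring
  rw [← hmul, ← hshift, ← hper.shift_eq_iff]
  refine eq_of_eq_on_progression ht (hper' _) (hper' _) fun i => ?_
  rw [seqShift_pow_apply, seqShift_pow_apply, mul_comm i t, add_comm, ← hmul, add_right_comm,
    hperiod, hmul, add_comm]

end Decimation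

/-! ### The bounds on N and on the linear complexity. -/

theorem lemma3p1 (R₁ R₂ : LinearRecurrence (ZMod 2)) (L₁ L₂ : ℕ)
    (hL₁ : R₁.order = L₁) (hL₂ : R₂.order = L₂)
    (hR₁ : IsMaximalLength R₁) (hR₂ : IsMaximalLength R₂)
    (hcop : Nat.Coprime L₁ L₂) (htwo : 2 ≤ L₂)
    (s₁ : Fin R₁.order → ZMod 2) (hs₁ : s₁ ≠ 0)
    (s₂ : Fin R₂.order → ZMod 2) (hs₂ : s₂ ≠ 0) :
    ∃ (P : (ZMod 2)[X]) (N : ℕ),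
      P.natDegree = L₂ ∧
      (2 : ℚ) ^ ((L₁ : ℤ) - 2) < (N : ℚ) ∧ (N : ℚ) ≤ (2 : ℚ) ^ ((L₁ : ℤ) - 1) ∧
      IsMinimalCharPoly (shrunken (R₁.mkSol s₁) (R₂.mkSol s₂)) (P ^ N) ∧
      ∃ LC : ℕ, IsLinearComplexity (shrunken (R₁.mkSol s₁) (R₂.mkSol s₂)) LC ∧
        (L₂ : ℚ) * (2 : ℚ) ^ ((L₁ : ℤ) - 2) < (LC : ℚ) ∧
        (LC : ℚ) ≤ (L₂ : ℚ) * (2 : ℚ) ^ ((L₁ : ℤ) - 1) := by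
  subst hL₁ hL₂
  have hpos : 0 < R₁.order := by
    obtain ⟨i, -⟩ := Function.ne_iff.mp hs₁
    exact i.pos
  have ha := R₁.is_sol_mkSol s₁
  have hb := R₂.is_sol_mkSol s₂
  have ha0 := mkSol_ne_zero hs₁
  have hb0 := mkSol_ne_zero hs₂
  have hpera := hR₁.isLeastPeriod ha ha0
  have hinf := infinite_ones hpera ha0
  have hcount := hR₁.count_eq ha ha0 hpos
  have ht : Nat.Coprime (2 ^ R₁.order - 1) (2 ^ R₂.order - 1) := by
    rw [Nat.Coprime, Nat.pow_sub_one_gcd_pow_sub_one, hcop, pow_one]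
  have hk := Nat.nth_add_of_periodic (fun n => by rw [hpera.1.2 n]) hinf
  rw [hcount] at hk
  obtain ⟨P, N, hdeg, hmon, hN0, hNle, hPdvd, hann⟩ :=
    hR₂.exists_minimalCharPoly_comp hb hb0 hk ht
  have hmin : IsMinimalCharPoly (shrunken (R₁.mkSol s₁) (R₂.mkSol s₂)) (P ^ N) :=
    isMinimalCharPoly_of_forall (hmon.pow N) hann
  have hlow : 2 ≤ R₁.order → 2 ^ (R₁.order - 2) < N := by
    intro h2
    by_contra! hle
    have hexp : R₁.order - 1 = R₁.order - 2 + 1 := by omega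
    rw [hexp] at hk
    have hpos' := hR₂.positions_modEq hb hb0 hk ht hPdvd ((hann _).mpr (pow_dvd_pow P hle))
    set T := 2 ^ R₂.order - 1
    set x := (2 ^ R₁.order - 1) * (T / 2)
    have hT : 2 ≤ T := by
      have := Nat.pow_le_pow_right two_pos htwo
      omega
    -- x(T - 1) stands for -x mod T, since C is a natural number.
    refine hR₁.gaps_not_periodic ha ha0 h2 hT (C := x * (T - 1)) fun j => ?_
    refine Nat.ModEq.trans ?_ ((hpos' j).add_right (x * (T - 1)))
    have hxT : x + x * (T - 1) = T * x := by
      obtain ⟨n, hn⟩ := Nat.exists_eq_add_of_le hT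
      rw [hn, show 2 + n - 1 = n + 1 by omega]
      ring
    rw [add_assoc, hxT]
    simp [Nat.ModEq]
  have hupQ : (N : ℚ) ≤ (2 : ℚ) ^ ((R₁.order : ℤ) - 1) := by
    have : ((R₁.order : ℤ) - 1) = ((R₁.order - 1 : ℕ) : ℤ) := by omega
    rw [this, zpow_natCast]
    exact_mod_cast hNle
  have hlowQ : (2 : ℚ) ^ ((R₁.order : ℤ) - 2) < (N : ℚ) := by
    by_cases h2 : 2 ≤ R₁.order
    · have : ((R₁.order : ℤ) - 2) = ((R₁.order - 2 : ℕ) : ℤ) := by omega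
      rw [this, zpow_natCast]
      exact_mod_cast hlow h2
    · have : ((R₁.order : ℤ) - 2) = -1 := by omega
      have h1 : (1 : ℚ) ≤ N := by exact_mod_cast hN0
      rw [this]
      norm_num
      linarith
  have hL₂ : (0 : ℚ) < R₂.order := by
    exact_mod_cast (by omega : 0 < R₂.order)
  refine ⟨P, N, hdeg, hlowQ, hupQ, hmin, _, hmin.isLinearComplexity, ?_, ?_⟩
  all_goals rw [natDegree_pow, hdeg, Nat.cast_mul, mul_comm (N : ℚ)]
  · exact mul_lt_mul_of_pos_left hlowQ hL₂
  · exact mul_le_mul_of_nonneg_left hupQ hL₂.le
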